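/- Let $d\ge 1$, $s\in(0,1)$ and $\sigma>0$. There is a constant $C>0$, depending only on $d$, $s$ and $\sigma$, such that the following holds. Let $\Omega\subset\mathbb R^d$ be a bounded Lipschitz domain (connectedness is not needed) and let $\mathcal T$ be a finite conforming simplicial mesh, consisting of closed nondegenerate $d$-simplices any two of which are disjoint or meet in a common face, such that * $\mathcal T$ is shape-regular with parameter $\sigma$: $h_T/\rho_T\le\sigma$ for all $T\in\mathcal T$, where $h_T=\operatorname{diam}(T)$ and $\rho_T$ is the diameter of the largest ball contained in $T$; in dimension $d=1$, where $h_T/\rho_T=1$ for every interval, it is also required that $h_T\le\sigma h_{T'}$ for all $T,T'\in\mathcal T$ with $T\cap T'\ne\emptyset$; * $\overline\Omega$ is contained in the interior of the computational domain $\bigcup_{T\in\mathcal T}T$; * the set $\mathcal T(\Omega)=\{T\in\mathcal T: T\cap\Omega\ne\emptyset\}$ is a triangulation of $\overline\Omega$, i.e. $\bigcup_{T\in\mathcal T(\Omega)}T=\overline\Omega$. For $T\in\mathcal T$ let $S^1_T=\bigcup\{T'\in\mathcal T: T'\cap T\neq\emptyset\}$. Let $$|q|_{H^s(\mathbb R^d)}^2=\frac{\nu(d,s)}2\iint_{\mathbb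 R^d\times\mathbb R^d}\frac{|q(x)-q(y)|^2}{|x-y|^{d+2s}}\,dx\,dy,\qquad \nu(d,s)=\frac{2^{2s}s\,\Gamma(s+\frac d2)}{\pi^{d/2}\,\Gamma(1-s)},$$ and let $\widetilde H^s(\Omega)$ be the space of all real-valued $q\in L^2(\mathbb R^d)$ with $|q|_{H^s(\mathbb R^d)}<\infty$ and $\operatorname{supp}q\subset\overline\Omega$, normed by $\|q\|_{\widetilde H^s(\Omega)}=|q|_{H^s(\mathbb R^d)}$. Then for all $q\in\widetilde H^s(\Omega)$, $$\|q\|_{\widetilde H^s(\Omega)}^2=|q|_{H^s(\mathbb R^d)}^2\le C\sum_{T\in\mathcal T(\Omega)}\left(\iint_{T\times S^1_T}\frac{|q(x)-q(y)|^2}{|x-y|^{d+2s}}\,dy\,dx+\frac{\|q\|_{L^2(T)}^2}{h_T^{2s}}\right).$$ -/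

import Mathlib

open MeasureTheory Set
open scoped ENNReal NNReal

noncomputable section

namespace FracLoc

/-- Euclidean space `ℝᵈ`. -/
abbrev Rd (d : ℕ) : Type := EuclideanSpace ℝ (Fin d)

/-- A bounded open set which, near each of its boundary points and in suitable orthonormal
coordinates, is the set of points lying below the graph of a Lipschitz function: `e` is the
vertical unit vector and `g` a Lipschitz function on the hyperplane orthogonal to `e`.
(Connectedness is not required.) -/
structure IsBoundedLipschitzDomain {d : ℕ} (Ω : Set (Rd d)) : Prop where
  isOpen : IsOpen Ω
  isBounded : Bornology.IsBounded Ω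
  locally_graph : ∀ x ∈ frontier Ω, ∃ (e : Rd d) (K : ℝ≥0) (g : (ℝ ∙ e)ᗮ → ℝ) (r : ℝ),
    ‖e‖ = 1 ∧ LipschitzWith K g ∧ 0 < r ∧
      ∀ y ∈ Metric.ball x r,
        (y ∈ Ω ↔ inner ℝ e y < g ((ℝ ∙ e)ᗮ.orthogonalProjectionOnto y))

/-! ### Fractional Sobolev spaces -/

/-- The constant `ν(d,s) = 2^{2s} s Γ(s + d/2) / (π^{d/2} Γ(1-s))` of the fractional Laplacian. -/
def nu (d : ℕ) (s : ℝ) : ℝ :=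
  2 ^ (2 * s) * s * Real.Gamma (s + d / 2) / (Real.pi ^ ((d : ℝ) / 2) * Real.Gamma (1 - s))

/-- The Gagliardo double integral `∬_{A × B} |w(x) - w(y)|² / |x - y|^{d+2s} dy dx`, with values
in `[0,∞]`. -/
def gagliardo {d : ℕ} (s : ℝ) (A B : Set (Rd d)) (w : Rd d → ℝ) : ℝ≥0∞ :=
  ∫⁻ x in A, ∫⁻ y in B, ENNReal.ofReal (|w x - w y| ^ 2 / ‖x - y‖ ^ ((d : ℝ) + 2 * s))

/-- The seminorm `|w|_{Hˢ(ℝᵈ)} = (ν(d,s)/2 ∬_{ℝᵈ×ℝᵈ} |w(x) - w(y)|² / |x - y|^{d+2s})^{1/2}`,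
with values in `[0,∞]`. -/
def hsSeminorm {d : ℕ} (s : ℝ) (w : Rd d → ℝ) : ℝ≥0∞ :=
  (ENNReal.ofReal (nu d s / 2) * gagliardo s univ univ w) ^ (1 / 2 : ℝ)

/-- Membership in `Hˢ(ℝᵈ)`: square integrable with finite seminorm. -/
def MemHs {d : ℕ} (s : ℝ) (w : Rd d → ℝ) : Prop :=
  MemLp w 2 volume ∧ hsSeminorm s w < ∞

/-- Membership in `H̃ˢ(Ω)`: functions in `Hˢ(ℝᵈ)` whose (essential) support lies in the closure
of `Ω`, that is, which vanish almost everywhere in the open set `ℝᵈ \ closure Ω`. -/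
def MemTildeHs {d : ℕ} (s : ℝ) (Ω : Set (Rd d)) (w : Rd d → ℝ) : Prop :=
  MemHs s w ∧ ∀ᵐ x ∂(volume : Measure (Rd d)), x ∉ closure Ω → w x = 0

/-! ### Simplicial meshes -/

/-- A (conforming) simplicial mesh in `ℝᵈ`: a finite simplicial complex each of whose faces is a
face of a `d`-dimensional simplex of the complex. -/
structure SimplicialMesh (d : ℕ) where
  complex : Geometry.SimplicialComplex ℝ (Rd d)
  finite_faces : complex.faces.Finite
  pure : ∀ t ∈ complex.faces, ∃ u ∈ complex.faces, t ⊆ u ∧ u.card = d + 1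

/-- The closed simplex with vertex set `t`. -/
def simplex {d : ℕ} (t : Finset (Rd d)) : Set (Rd d) := convexHull ℝ (t : Set (Rd d))

/-- The diameter `h_T` of a set `T`. -/
def hDiam {d : ℕ} (T : Set (Rd d)) : ℝ := Metric.diam T

/-- The diameter `ρ_T` of the largest ball contained in `T`. -/
def rhoDiam {d : ℕ} (T : Set (Rd d)) : ℝ :=
  sSup {δ : ℝ | ∃ (c : Rd d) (r : ℝ), 0 ≤ r ∧ δ = 2 * r ∧ Metric.closedBall c r ⊆ T}

namespace SimplicialMesh

variable {d : ℕ} (M : SimplicialMesh d)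

/-- The elements of the mesh (its `d`-dimensional simplices), given by their vertex sets. -/
def elements : Finset (Finset (Rd d)) :=
  M.finite_faces.toFinset.filter (fun t => t.card = d + 1)

/-- The computational domain covered by the mesh: the union of its elements. -/
def domain : Set (Rd d) := ⋃ t ∈ M.elements, simplex t

open Classical in
/-- `𝒯(Ω)`: the elements that meet `Ω`. -/
def elementsMeeting (Ω : Set (Rd d)) : Finset (Finset (Rd d)) :=
  M.elements.filter (fun t => (simplex t ∩ Ω).Nonempty)

/-- The patch `S¹_T`: the union of all elements of the mesh that meet `T`. -/
def patch (t : Finset (Rd d)) : Set (Rd d) :=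
  ⋃ t' ∈ M.elements, ⋃ (_ : (simplex t' ∩ simplex t).Nonempty), simplex t'

/-- Shape regularity with parameter `σ`: `h_T / ρ_T ≤ σ` for all elements `T`. For `d ≥ 2` this
makes the diameters of neighbouring elements comparable. For `d = 1`, where `h_T / ρ_T = 1` for
every interval, this comparability (local quasi-uniformity) is part of the notion. -/
structure ShapeRegular (σ : ℝ) : Prop where
  ratio_le : ∀ t ∈ M.elements, hDiam (simplex t) / rhoDiam (simplex t) ≤ σ
  locally_quasiuniform_of_one : d = 1 → ∀ t ∈ M.elements, ∀ t' ∈ M.elements,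
    (simplex t ∩ simplex t').Nonempty → hDiam (simplex t) ≤ σ * hDiam (simplex t')

/-- The mesh is fitted to `Ω`: the closure of `Ω` lies in the interior of the computational domain,
and the elements that meet `Ω` form a triangulation of the closure of `Ω`. -/
structure FittedTo (Ω : Set (Rd d)) : Prop where
  closure_subset_interior : closure Ω ⊆ interior M.domain
  iUnion_elementsMeeting : ⋃ t ∈ M.elementsMeeting Ω, simplex t = closure Ω

end SimplicialMesh

end FracLoc

end

/-! Since `q` vanishes off `closure Ω`, the double integral over all of space is at most twice the
integral over `closure Ω × ℝᵈ`. For `x` in an element `T`, the `y` in the patch of `T` give the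
local terms. For `y` outside it, `|q x - q y|² ≤ 2 (q x)² + 2 (q y)²`, and everything rests on one
geometric fact (`ShapeRegular.hDiam_le_mul_dist`): such `y` have distance at least `h_T / κ` from
`T`, with `κ` depending only on `d` and `σ`. The tail of the kernel beyond radius `R` integrates to
at most a multiple of `R^{-2s}`, which settles the term in `q x`. In the term in `q y`, being
outside the patch is a symmetric relation for almost every `x`; so if `y` lies in `T'`, the kernel
may be truncated at `h_T' / κ` instead. Fubini and an `x`-integral over the whole space then give
the weight `h_T'^{-2s}`, without counting overlaps of patches.

The geometric fact compares hat functions. Some barycentric coordinate of `x` in `T` is at least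
`1/(d+1)`, say at the vertex `v`. The hat function of `v` has slope at most a multiple of `1 / h_T`
on the star of `v`, once the elements there have comparable diameters. For `d ≥ 2` comparability
holds because elements sharing an edge are comparable, volume bounds the number of elements at `v`,
and connectedness of small spheres about the interior vertex `v` links them all through edges at
`v`. -/

noncomputable section

namespace FracLoc

variable {d : ℕ}

/-! ### Barycentric coordinates and intersections of elements -/

namespace SimplicialMesh

variable {M : SimplicialMesh d} {t t' : Finset (Rd d)}

theorem mem_faces_of_mem_elements (ht : t ∈ M.elements) : t ∈ M.complex.faces := by
  simp only [elements, Finset.mem_filter, Set.Finite.mem_toFinset] at ht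
  exact ht.1

theorem card_of_mem_elements (ht : t ∈ M.elements) : t.card = d + 1 := by
  simp only [elements, Finset.mem_filter] at ht
  exact ht.2

/-- The vertices of an element as an affine basis, giving access to barycentric coordinates. -/
def basis (ht : t ∈ M.elements) : AffineBasis t ℝ (Rd d) where
  toFun := (↑)
  ind' := M.complex.indep (mem_faces_of_mem_elements ht)
  tot' := by
    rw [(M.complex.indep
      (mem_faces_of_mem_elements ht)).affineSpan_eq_top_iff_card_eq_finrank_add_one]
    simp [card_of_mem_elements ht]

theorem range_basis (ht : t ∈ M.elements) : range (basis ht) = (t : Set (Rd d)) :=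
  Subtype.range_coe

theorem simplex_eq_nonneg_coord (ht : t ∈ M.elements) :
    simplex t = {x | ∀ i, 0 ≤ (basis ht).coord i x} := by
  rw [← AffineBasis.convexHull_eq_nonneg_coord, range_basis, simplex]

theorem coord_nonneg (ht : t ∈ M.elements) {x : Rd d} (hx : x ∈ simplex t) (i : t) :
    0 ≤ (basis ht).coord i x := by
  rw [simplex_eq_nonneg_coord ht] at hx
  exact hx i

theorem coord_le_one (ht : t ∈ M.elements) {x : Rd d} (hx : x ∈ simplex t) (i : t) :
    (basis ht).coord i x ≤ 1 := by
  rw [← (basis ht).sum_coord_apply_eq_one x]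
  exact Finset.single_le_sum (fun j _ => coord_nonneg ht hx j) (Finset.mem_univ i)

theorem coord_vertex (ht : t ∈ M.elements) (v w : t) :
    (basis ht).coord v (w : Rd d) = if v = w then 1 else 0 :=
  (basis ht).coord_apply v w

theorem mem_simplex_of_mem {v : Rd d} (hv : v ∈ t) : v ∈ simplex t :=
  subset_convexHull ℝ _ hv

theorem interior_simplex_nonempty (ht : t ∈ M.elements) : (interior (simplex t)).Nonempty := by
  rw [simplex, interior_convexHull_nonempty_iff_affineSpan_eq_top, ← range_basis ht]
  exact (basis ht).tot

theorem simplex_inter_subset (ht : t ∈ M.elements) (ht' : t' ∈ M.elements) :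
    simplex t ∩ simplex t' ⊆ convexHull ℝ (t ∩ t' : Set (Rd d)) :=
  M.complex.inter_subset_convexHull (mem_faces_of_mem_elements ht) (mem_faces_of_mem_elements ht')

/-- Barycentric coordinates of two elements agree on their intersection. -/
theorem coord_eq_coord (ht : t ∈ M.elements) (ht' : t' ∈ M.elements) {v : Rd d} (hv : v ∈ t)
    (hv' : v ∈ t') {x : Rd d} (hx : x ∈ simplex t) (hx' : x ∈ simplex t') :
    (basis ht).coord ⟨v, hv⟩ x = (basis ht').coord ⟨v, hv'⟩ x := by
  have hmem := simplex_inter_subset ht ht' ⟨hx, hx'⟩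
  have hspan := convexHull_subset_affineSpan (𝕜 := ℝ) _ hmem
  refine AffineMap.eqOn_affineSpan (k := ℝ) (f := (basis ht).coord ⟨v, hv⟩)
    (g := (basis ht').coord ⟨v, hv'⟩) ?_ hspan
  rintro w ⟨hw, hw'⟩
  have h1 := coord_vertex ht ⟨v, hv⟩ ⟨w, hw⟩
  have h2 := coord_vertex ht' ⟨v, hv'⟩ ⟨w, hw'⟩
  simp only [Subtype.mk.injEq] at h1 h2
  rw [h1, h2]

/-- Distinct elements overlap in a null set. -/
theorem volume_inter_eq_zero (ht : t ∈ M.elements) (ht' : t' ∈ M.elements) (hne : t ≠ t') :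
    volume (simplex t ∩ simplex t') = 0 := by
  refine measure_mono_null ((simplex_inter_subset ht ht').trans
    (convexHull_subset_affineSpan (𝕜 := ℝ) _)) (Measure.addHaar_affineSubspace _ _ ?_)
  intro htop
  have hlt : (t ∩ t').card < d + 1 := by
    rw [← card_of_mem_elements ht]
    refine Finset.card_lt_card (Finset.ssubset_iff_subset_ne.2 ⟨Finset.inter_subset_left, ?_⟩)
    intro h
    exact hne (Finset.eq_of_subset_of_card_le (Finset.inter_eq_left.1 h)
      (by rw [card_of_mem_elements ht, card_of_mem_elements ht']))
  have hind : AffineIndependent ℝ ((↑) : (t ∩ t' : Finset (Rd d)) → Rd d) :=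
    (M.complex.indep (mem_faces_of_mem_elements ht)).mono
      (by simp [Finset.coe_inter])
  have hcard := hind.affineSpan_eq_top_iff_card_eq_finrank_add_one.1
    (by rw [← htop]; congr 1; ext; simp)
  simp only [Fintype.card_coe, finrank_euclideanSpace, Fintype.card_fin] at hcard
  omega

end SimplicialMesh

/-! ### Inscribed balls and slopes of barycentric coordinates -/

theorem isCompact_simplex (t : Finset (Rd d)) : IsCompact (simplex t) :=
  t.finite_toSet.isCompact_convexHull ℝ

/-- An affine function with values in `[0,1]` on a ball of radius `r` has slope at most `1/(2r)`. -/
theorem abs_affine_sub_le {E : Type*} [NormedAddCommGroup E] [NormedSpace ℝ E] (a : E →ᵃ[ℝ] ℝ)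
    {c : E} {r : ℝ} (hr : 0 < r) (ha : ∀ x ∈ Metric.closedBall c r, a x ∈ Icc (0 : ℝ) 1)
    (x y : E) : 2 * r * |a x - a y| ≤ ‖x - y‖ := by
  rcases eq_or_ne x y with rfl | hxy
  · simp
  have hn : 0 < ‖x - y‖ := norm_pos_iff.2 (sub_ne_zero.2 hxy)
  -- The points `c ± u` are the ends of a diameter parallel to `x - y`; between them `a` changes by
  -- at most 1.
  set u : E := (r / ‖x - y‖) • (x - y) with hu
  have hun : ‖u‖ = r := by
    rw [hu, norm_smul, Real.norm_of_nonneg (by positivity)]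
    field_simp
  have h1 := ha (c + u) (by simp [hun])
  have h2 := ha (c - u) (by simp [hun])
  have e0 : a.linear (x - y) = a x - a y := by
    simpa using a.linearMap_vsub x y
  have e1 : a (c + u) - a (c - u) = 2 * (r / ‖x - y‖) * (a x - a y) := by
    have := a.linearMap_vsub (c + u) (c - u)
    simp only [vsub_eq_sub] at this
    rw [← this, ← e0, show c + u - (c - u) = (2 * (r / ‖x - y‖)) • (x - y) by
      rw [hu]; module]
    simp
  have h3 : |a (c + u) - a (c - u)| ≤ 1 := by
    rw [abs_le]; constructor <;> linarith [h1.1, h1.2, h2.1, h2.2]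
  rw [e1, abs_mul, abs_of_pos (by positivity)] at h3
  have h4 := mul_le_mul_of_nonneg_right h3 hn.le
  have : 2 * (r / ‖x - y‖) * |a x - a y| * ‖x - y‖ = 2 * r * |a x - a y| := by
    field_simp
  linarith

namespace SimplicialMesh

variable {M : SimplicialMesh d} {t t' : Finset (Rd d)}

theorem dist_le_hDiam {x y : Rd d} (hx : x ∈ simplex t) (hy : y ∈ simplex t) :
    dist x y ≤ hDiam (simplex t) :=
  Metric.dist_le_diam_of_mem (isCompact_simplex t).isBounded hx hy

theorem two_mul_le_hDiam (hd : 1 ≤ d) {c : Rd d} {r : ℝ} (hr : 0 ≤ r)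
    (h : Metric.closedBall c r ⊆ simplex t) : 2 * r ≤ hDiam (simplex t) := by
  have : Nonempty (Fin d) := ⟨⟨0, hd⟩⟩
  rw [← Metric.diam_closedBall_eq c hr]
  exact Metric.diam_mono h (isCompact_simplex t).isBounded

/-- An element of a shape regular mesh contains a ball of comparable radius. -/
theorem ShapeRegular.exists_closedBall_subset (hd : 1 ≤ d) {σ : ℝ} (hσ : M.ShapeRegular σ)
    (ht : t ∈ M.elements) :
    0 < σ ∧ ∃ (c : Rd d) (r : ℝ), 0 < r ∧ hDiam (simplex t) ≤ 4 * σ * r ∧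
      Metric.closedBall c r ⊆ simplex t := by
  obtain ⟨c, hc⟩ := interior_simplex_nonempty ht
  obtain ⟨ε, hε, hball⟩ := Metric.mem_nhds_iff.1 (mem_interior_iff_mem_nhds.1 hc)
  have hsub : Metric.closedBall c (ε / 2) ⊆ simplex t :=
    (Metric.closedBall_subset_ball (by linarith)).trans hball
  set S : Set ℝ := {δ : ℝ | ∃ (c : Rd d) (r : ℝ), 0 ≤ r ∧ δ = 2 * r ∧
    Metric.closedBall c r ⊆ simplex t} with hS
  have hbdd : BddAbove S := by
    refine ⟨hDiam (simplex t), ?_⟩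
    rintro δ ⟨c, r, hr, rfl, h⟩
    exact two_mul_le_hDiam hd hr h
  have hmem : ε ∈ S := ⟨c, ε / 2, by linarith, by ring, hsub⟩
  have hρ : 0 < rhoDiam (simplex t) := hε.trans_le (le_csSup hbdd hmem)
  have hh : 0 < hDiam (simplex t) := by
    have := two_mul_le_hDiam hd (by linarith) hsub
    linarith
  have hratio := hσ.ratio_le t ht
  have hσ0 : 0 < σ := (div_pos hh hρ).trans_le hratio
  rw [div_le_iff₀ hρ] at hratio
  -- Settling for a ball of diameter above half the supremum avoids proving that it is attained;
  -- this is why the constant is `4σ` and not `2σ`.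
  obtain ⟨δ, ⟨c', r, hr, rfl, h⟩, hlt⟩ := exists_lt_of_lt_csSup (s := S) ⟨ε, hmem⟩
    (show rhoDiam (simplex t) / 2 < sSup S from half_lt_self hρ)
  refine ⟨hσ0, c', r, by linarith, ?_, h⟩
  nlinarith

theorem hDiam_pos (hd : 1 ≤ d) (ht : t ∈ M.elements) : 0 < hDiam (simplex t) := by
  obtain ⟨c, hc⟩ := interior_simplex_nonempty ht
  obtain ⟨ε, hε, hball⟩ := Metric.mem_nhds_iff.1 (mem_interior_iff_mem_nhds.1 hc)
  have := two_mul_le_hDiam hd (by linarith)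
    ((Metric.closedBall_subset_ball (by linarith : ε / 2 < ε)).trans hball)
  linarith

/-- Barycentric coordinates are Lipschitz with constant `2σ/h`. -/
theorem ShapeRegular.hDiam_mul_abs_coord_sub_le (hd : 1 ≤ d) {σ : ℝ} (hσ : M.ShapeRegular σ)
    (ht : t ∈ M.elements) (v : t) (x y : Rd d) :
    hDiam (simplex t) * |(basis ht).coord v x - (basis ht).coord v y| ≤ 2 * σ * ‖x - y‖ := by
  obtain ⟨hσ0, c, r, hr, hhr, hball⟩ := hσ.exists_closedBall_subset hd ht
  have h := abs_affine_sub_le ((basis ht).coord v) hr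
    (fun z hz => ⟨coord_nonneg ht (hball hz) v, coord_le_one ht (hball hz) v⟩) x y
  calc hDiam (simplex t) * |(basis ht).coord v x - (basis ht).coord v y|
      ≤ 4 * σ * r * |(basis ht).coord v x - (basis ht).coord v y| := by gcongr
    _ = 2 * σ * (2 * r * |(basis ht).coord v x - (basis ht).coord v y|) := by ring
    _ ≤ 2 * σ * ‖x - y‖ := by gcongr

/-- Elements with a common edge have comparable diameters. -/
theorem ShapeRegular.hDiam_le_of_common_edge (hd : 1 ≤ d) {σ : ℝ} (hσ : M.ShapeRegular σ)
    (ht : t ∈ M.elements) {v w : Rd d} (hvw : v ≠ w) (hv : v ∈ t) (hw : w ∈ t) (hv' : v ∈ t')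
    (hw' : w ∈ t') : hDiam (simplex t) ≤ 2 * σ * hDiam (simplex t') := by
  -- The coordinate of `v` drops from 1 to 0 along the edge `vw`, so this edge, which also lies in
  -- `t'`, has length at least `h_t / (2σ)`.
  have h := hσ.hDiam_mul_abs_coord_sub_le hd ht ⟨v, hv⟩ v w
  have h1 := coord_vertex ht ⟨v, hv⟩ ⟨v, hv⟩
  have h2 := coord_vertex ht ⟨v, hv⟩ ⟨w, hw⟩
  simp only [Subtype.mk.injEq, hvw, if_true, if_false] at h1 h2
  rw [h1, h2, sub_zero, abs_one, mul_one, ← dist_eq_norm] at h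
  have hσ0 := (hσ.exists_closedBall_subset hd ht).1
  have := dist_le_hDiam (mem_simplex_of_mem hv') (mem_simplex_of_mem hw')
  calc _ ≤ _ := h
    _ ≤ _ := by gcongr

end SimplicialMesh

/-! ### Slopes along a segment covered by closed pieces -/

/-- A function patched together from finitely many pieces, each of which does not decrease faster
than with slope `L` on its closed domain, does not decrease faster than with slope `L`. -/
theorem sub_le_mul_sub_of_closed_cover {ι : Type*} [DecidableEq ι] {C : ι → Set ℝ}
    (hC : ∀ i, IsClosed (C i)) {f : ι → ℝ → ℝ} {L : ℝ}
    (hcons : ∀ i j x, x ∈ C i → x ∈ C j → f i x = f j x)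
    (hlip : ∀ i, ∀ x ∈ C i, ∀ y ∈ C i, x ≤ y → f i x - f i y ≤ L * (y - x)) (S : Finset ι) :
    ∀ {a b : ℝ} {i j : ι}, a ≤ b → i ∈ S → a ∈ C i → b ∈ C j → Icc a b ⊆ ⋃ k ∈ S, C k →
      f i a - f j b ≤ L * (b - a) := by
  induction S using Finset.strongInduction with
  | H S ih =>
    intro a b i j hab hi ha hb hcov
    -- `m` is the last point of `[a, b]` in piece `i`. The other pieces cover `(m, b]` and, being
    -- closed, also `m`; so one can change piece at `m` and never need `i` again.
    obtain ⟨m, ⟨hmC, hm⟩, hmax⟩ := ((isCompact_Icc (a := a) (b := b)).inter_left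
      (hC i)).exists_isGreatest ⟨a, ha, left_mem_Icc.2 hab⟩
    rcases hm.2.eq_or_lt with rfl | hmb
    · rw [← hcons i j m hmC hb]
      exact hlip i a ha m hmC hab
    · have hIoc : Ioc m b ⊆ ⋃ k ∈ S.erase i, C k := by
        intro x hx
        obtain ⟨k, hk, hxk⟩ := mem_iUnion₂.1 (hcov ⟨hm.1.trans hx.1.le, hx.2⟩)
        refine mem_iUnion₂.2 ⟨k, Finset.mem_erase.2 ⟨?_, hk⟩, hxk⟩
        rintro rfl
        exact (hmax ⟨hxk, hm.1.trans hx.1.le, hx.2⟩).not_gt hx.1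
      have hIcc : Icc m b ⊆ ⋃ k ∈ S.erase i, C k := by
        rw [← closure_Ioc hmb.ne]
        exact closure_minimal hIoc (isClosed_biUnion_finset fun k _ => hC k)
      obtain ⟨k, hk, hmk⟩ := mem_iUnion₂.1 (hIcc (left_mem_Icc.2 hmb.le))
      have h1 := ih _ (Finset.erase_ssubset hi) hmb.le hk hmk hb hIcc
      have h2 := hlip i a ha m hmC hm.1
      rw [hcons i k m hmC hmk] at h2
      linarith

/-! ### Stars of vertices and local quasi-uniformity -/

namespace SimplicialMesh

variable {M : SimplicialMesh d} {t t' : Finset (Rd d)} {v : Rd d}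

open Classical in
/-- The elements with vertex `v`. -/
def star (M : SimplicialMesh d) (v : Rd d) : Finset (Finset (Rd d)) :=
  M.elements.filter (v ∈ ·)

theorem mem_star : t ∈ M.star v ↔ t ∈ M.elements ∧ v ∈ t := by
  simp [star]

/-- A vertex of the mesh belongs only to the elements of which it is a vertex. -/
theorem mem_of_mem_simplex (ht : t ∈ M.elements) (hv : v ∈ t) (ht' : t' ∈ M.elements)
    (hv' : v ∈ simplex t') : v ∈ t' := by
  by_contra hcon
  have hmem := simplex_inter_subset ht ht' ⟨mem_simplex_of_mem hv, hv'⟩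
  -- If `v` is not a vertex of `t'`, its coordinate in `t` vanishes at all common vertices, hence on
  -- their hull, which contains `v`.
  have h0 : (basis ht).coord ⟨v, hv⟩ v = 0 := by
    refine AffineMap.eqOn_affineSpan (k := ℝ) (f := (basis ht).coord ⟨v, hv⟩)
      (g := AffineMap.const ℝ (Rd d) (0 : ℝ)) ?_ (convexHull_subset_affineSpan (𝕜 := ℝ) _ hmem)
    rintro w ⟨hw, hw'⟩
    have h := coord_vertex ht ⟨v, hv⟩ ⟨w, hw⟩
    have hne : v ≠ w := by
      rintro rfl
      exact hcon hw'
    simpa [hne] using h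
  have h1 := coord_vertex ht ⟨v, hv⟩ ⟨v, hv⟩
  simp only [if_true] at h1
  linarith

/-- The finitely many elements without the vertex `v` form a closed set that misses `v`. -/
theorem exists_ball_subset_star (ht : t ∈ M.elements) (hv : v ∈ t) (hint : v ∈ interior M.domain) :
    ∃ r > 0, Metric.ball v r ⊆ ⋃ u ∈ M.star v, simplex u := by
  classical
  have hcl : IsClosed (⋃ u ∈ M.elements.filter (v ∉ ·), simplex u) :=
    isClosed_biUnion_finset fun u _ => (isCompact_simplex u).isClosed
  have hmem : v ∈ interior M.domain ∩ (⋃ u ∈ M.elements.filter (v ∉ ·), simplex u)ᶜ := by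
    refine ⟨hint, fun hcon => ?_⟩
    obtain ⟨u, hu, hvu⟩ := mem_iUnion₂.1 hcon
    rw [Finset.mem_filter] at hu
    exact hu.2 (mem_of_mem_simplex ht hv hu.1 hvu)
  obtain ⟨r, hr, hball⟩ := Metric.isOpen_iff.1 (isOpen_interior.inter hcl.isOpen_compl) v hmem
  refine ⟨r, hr, fun x hx => ?_⟩
  obtain ⟨h1, h2⟩ := hball hx
  obtain ⟨u, hu, hxu⟩ := mem_iUnion₂.1 (interior_subset h1)
  refine mem_iUnion₂.2 ⟨u, mem_star.2 ⟨hu, ?_⟩, hxu⟩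
  by_contra hvu
  exact h2 (mem_iUnion₂.2 ⟨u, Finset.mem_filter.2 ⟨hu, hvu⟩, hxu⟩)

theorem exists_mem_ne (hd : 1 ≤ d) (ht : t ∈ M.elements) (v : Rd d) : ∃ w ∈ t, w ≠ v :=
  Finset.exists_mem_ne (by rw [card_of_mem_elements ht]; omega) v

theorem exists_mem_sphere (hd : 1 ≤ d) (ht : t ∈ M.elements) (hv : v ∈ t) :
    ∃ R > 0, ∀ ρ, 0 < ρ → ρ ≤ R → (Metric.sphere v ρ ∩ simplex t).Nonempty := by
  obtain ⟨w, hw, hwv⟩ := exists_mem_ne hd ht v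
  have hpos : 0 < ‖w - v‖ := norm_pos_iff.2 (sub_ne_zero.2 hwv)
  refine ⟨‖w - v‖, hpos, fun ρ hρ hle => ⟨AffineMap.lineMap v w (ρ / ‖w - v‖), ?_, ?_⟩⟩
  · rw [mem_sphere_iff_norm, AffineMap.lineMap_apply, vsub_eq_sub, vadd_eq_add, add_sub_cancel_right,
      norm_smul, Real.norm_of_nonneg (by positivity)]
    field_simp
  · exact (convex_convexHull ℝ _).lineMap_mem (mem_simplex_of_mem hv) (mem_simplex_of_mem hw)
      ⟨by positivity, (div_le_one hpos).2 hle⟩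

/-- In dimension at least two the elements around an interior vertex are connected through common
edges at that vertex. -/
theorem exists_common_edge (hd : 2 ≤ d) (hint : v ∈ interior M.domain)
    {A : Finset (Finset (Rd d))} (hA : A ⊆ M.star v) (hne : A.Nonempty) (hAs : A ≠ M.star v) :
    ∃ a ∈ A, ∃ b ∈ M.star v, b ∉ A ∧ ∃ w, w ≠ v ∧ w ∈ a ∧ w ∈ b := by
  classical
  obtain ⟨a, ha⟩ := hne
  obtain ⟨b, hb, hbA⟩ := Finset.exists_of_ssubset (hA.ssubset_of_ne hAs)
  obtain ⟨hae, hva⟩ := mem_star.1 (hA ha)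
  obtain ⟨hbe, hvb⟩ := mem_star.1 hb
  obtain ⟨r, hr, hball⟩ := exists_ball_subset_star hae hva hint
  obtain ⟨Ra, hRa, hsa⟩ := exists_mem_sphere (by omega) hae hva
  obtain ⟨Rb, hRb, hsb⟩ := exists_mem_sphere (by omega) hbe hvb
  obtain ⟨ρ, hρ, hρlt⟩ := exists_between (lt_min hr (lt_min hRa hRb))
  obtain ⟨hρr, hρa, hρb⟩ : ρ < r ∧ ρ < Ra ∧ ρ < Rb := by simpa using hρlt
  have hrank : 1 < Module.rank ℝ (Rd d) := by
    rw [← Module.finrank_eq_rank, finrank_euclideanSpace, Fintype.card_fin]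
    exact_mod_cast hd
  -- A small sphere about `v` is connected, as `d ≥ 2`, and is covered by two closed sets that both
  -- meet it: the elements in `A` and the other elements at `v`.
  have hpre := isPreconnected_closed_iff.1 (isPreconnected_sphere hrank v ρ)
    (⋃ u ∈ A, simplex u) (⋃ u ∈ M.star v \ A, simplex u)
    (isClosed_biUnion_finset fun u _ => (isCompact_simplex u).isClosed)
    (isClosed_biUnion_finset fun u _ => (isCompact_simplex u).isClosed) ?_ ?_ ?_
  · obtain ⟨p, hp, hpA, hpB⟩ := hpre
    obtain ⟨a', ha', hpa⟩ := mem_iUnion₂.1 hpA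
    obtain ⟨b', hb', hpb⟩ := mem_iUnion₂.1 hpB
    rw [Finset.mem_sdiff] at hb'
    refine ⟨a', ha', b', hb'.1, hb'.2, ?_⟩
    by_contra! hcon
    have hmem := simplex_inter_subset (mem_star.1 (hA ha')).1 (mem_star.1 hb'.1).1 ⟨hpa, hpb⟩
    -- If `v` were the only common vertex, the common point `p` would be `v`, which is not on the
    -- sphere.
    have hsub : (a' ∩ b' : Set (Rd d)) ⊆ {v} := by
      rintro w ⟨hwa, hwb⟩
      by_contra hwv
      exact hcon w hwv hwa hwb
    have hpv : p = v := by simpa using convexHull_mono (𝕜 := ℝ) hsub hmem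
    rw [hpv, mem_sphere_iff_norm, sub_self, norm_zero] at hp
    linarith
  · intro p hp
    obtain ⟨u, hu, hpu⟩ := mem_iUnion₂.1 (hball (Metric.sphere_subset_ball hρr hp))
    by_cases huA : u ∈ A
    · exact Or.inl (mem_iUnion₂.2 ⟨u, huA, hpu⟩)
    · exact Or.inr (mem_iUnion₂.2 ⟨u, Finset.mem_sdiff.2 ⟨hu, huA⟩, hpu⟩)
  · exact (hsa ρ hρ hρa.le).mono (inter_subset_inter_right _ (subset_biUnion_of_mem ha))
  · exact (hsb ρ hρ hρb.le).mono (inter_subset_inter_right _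
      (subset_biUnion_of_mem (u := fun u => simplex u) (Finset.mem_sdiff.2 ⟨hb, hbA⟩)))

/-- Follows from `2r ≤ h ≤ 4σr` for an inscribed ball; it makes the powers of `2σ` monotone in the
exponent. -/
theorem ShapeRegular.one_le_two_mul (hd : 1 ≤ d) {σ : ℝ} (hσ : M.ShapeRegular σ)
    (ht : t ∈ M.elements) : 1 ≤ 2 * σ := by
  obtain ⟨hσ0, c, r, hr, hhr, hball⟩ := hσ.exists_closedBall_subset hd ht
  have h2 := two_mul_le_hDiam hd hr.le hball
  have h3 := hDiam_pos hd ht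
  have : hDiam (simplex t) ≤ 2 * σ * hDiam (simplex t) := by nlinarith
  nlinarith

/-- Near each of its vertices an element contains balls of size comparable to the distance to the
vertex. -/
theorem ShapeRegular.exists_closedBall_subset_inter (hd : 1 ≤ d) {σ : ℝ} (hσ : M.ShapeRegular σ)
    (ht : t ∈ M.elements) (hv : v ∈ t) {R : ℝ} (hR : 0 < R) (hRh : R ≤ hDiam (simplex t)) :
    ∃ c, Metric.closedBall c (R / (4 * σ)) ⊆ simplex t ∩ Metric.closedBall v R := by
  obtain ⟨hσ0, c, r, hr, hhr, hball⟩ := hσ.exists_closedBall_subset hd ht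
  have hh := hDiam_pos hd ht
  set h := hDiam (simplex t)
  have hk0 : 0 < R / h := by positivity
  have hk1 : R / h ≤ 1 := (div_le_one hh).2 hRh
  refine ⟨AffineMap.lineMap v c (R / h), fun x hx => ?_⟩
  -- The homothety at `v` with ratio `R / h` shrinks the inscribed ball; `y` is the preimage of `x`.
  set y : Rd d := AffineMap.lineMap v x (h / R) with hy
  have hxy : x = AffineMap.lineMap v y (R / h) := by
    rw [hy, AffineMap.lineMap_apply, AffineMap.lineMap_apply]
    simp only [vsub_eq_sub, vadd_eq_add, add_sub_cancel_right, smul_smul]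
    rw [show R / h * (h / R) = 1 by field_simp]
    simp
  have hyc : y - c = (h / R) • (x - AffineMap.lineMap v c (R / h)) := by
    rw [hy, AffineMap.lineMap_apply, AffineMap.lineMap_apply]
    simp only [vsub_eq_sub, vadd_eq_add, smul_sub, smul_add, smul_smul]
    rw [show h / R * (R / h) = 1 by field_simp]
    module
  have hyt : y ∈ simplex t := by
    apply hball
    rw [mem_closedBall_iff_norm, hyc, norm_smul, Real.norm_of_nonneg (by positivity)]
    rw [mem_closedBall_iff_norm] at hx
    calc h / R * ‖x - AffineMap.lineMap v c (R / h)‖ ≤ h / R * (R / (4 * σ)) := by gcongr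
      _ = h / (4 * σ) := by field_simp
      _ ≤ r := by rw [div_le_iff₀ (by positivity)]; linarith
  refine ⟨?_, ?_⟩
  · rw [hxy]
    exact (convex_convexHull ℝ _).lineMap_mem (mem_simplex_of_mem hv) hyt ⟨hk0.le, hk1⟩
  · have hdist := dist_le_hDiam hyt (mem_simplex_of_mem hv)
    rw [hxy, Metric.mem_closedBall, dist_lineMap_left, Real.norm_of_nonneg hk0.le, dist_comm]
    calc R / h * dist y v ≤ R / h * h := by gcongr
      _ = R := by field_simp

/-- The number of elements of a shape regular mesh at a vertex is bounded. -/
theorem ShapeRegular.card_star_le (hd : 1 ≤ d) {σ : ℝ} (hσ : M.ShapeRegular σ) (v : Rd d) :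
    ((M.star v).card : ℝ) ≤ (4 * σ) ^ d ∨ M.star v = ∅ := by
  -- Without an element at `v` the sign of `σ` is unknown, hence the alternative in the statement.
  rcases (M.star v).eq_empty_or_nonempty with h | hne
  · exact Or.inr h
  left
  -- With `R` the smallest diameter at `v`, every element there contains a ball of radius `R / (4σ)`
  -- inside `closedBall v R`; comparing volumes bounds their number.
  obtain ⟨t₀, ht₀, hmin⟩ := (M.star v).exists_min_image (fun t => hDiam (simplex t)) hne
  have hσ0 := (hσ.exists_closedBall_subset hd (mem_star.1 ht₀).1).1
  set R := hDiam (simplex t₀)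
  have hR : 0 < R := hDiam_pos hd (mem_star.1 ht₀).1
  have hex : ∀ t : M.star v, ∃ c, Metric.closedBall c (R / (4 * σ)) ⊆
      simplex t.1 ∩ Metric.closedBall v R := fun t =>
    hσ.exists_closedBall_subset_inter hd (mem_star.1 t.2).1 (mem_star.1 t.2).2 hR (hmin t t.2)
  choose c hc using hex
  have hdisj : Pairwise
      (Function.onFun (AEDisjoint volume) fun t : M.star v =>
        Metric.closedBall (c t) (R / (4 * σ))) := by
    intro t t' hne
    exact measure_mono_null (inter_subset_inter ((hc t).trans inter_subset_left)
      ((hc t').trans inter_subset_left)) (volume_inter_eq_zero (mem_star.1 t.2).1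
        (mem_star.1 t'.2).1 (fun h => hne (Subtype.ext h)))
  have hsum := measure_iUnion₀ hdisj
    (fun t => Metric.isClosed_closedBall.measurableSet.nullMeasurableSet)
  have hle : volume (⋃ t : M.star v, Metric.closedBall (c t) (R / (4 * σ))) ≤
      volume (Metric.closedBall v R) :=
    measure_mono (iUnion_subset fun t => (hc t).trans inter_subset_right)
  rw [hsum, tsum_fintype] at hle
  simp_rw [Measure.addHaar_closedBall (volume : Measure (Rd d)) _ (show 0 ≤ R / (4 * σ) by positivity),
    Measure.addHaar_closedBall (volume : Measure (Rd d)) _ hR.le] at hle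
  rw [Finset.sum_const, Finset.card_univ, Fintype.card_coe, nsmul_eq_mul, ← mul_assoc,
    ENNReal.mul_le_mul_iff_left (Metric.measure_ball_pos _ _ one_pos).ne' measure_ball_lt_top.ne,
    ← ENNReal.ofReal_natCast, ← ENNReal.ofReal_mul (by positivity),
    ENNReal.ofReal_le_ofReal_iff (by positivity), finrank_euclideanSpace, Fintype.card_fin, div_pow,
    mul_div_assoc', div_le_iff₀ (by positivity), mul_comm (R ^ d)] at hle
  exact le_of_mul_le_mul_right hle (by positivity)

/-- A bound for the ratio of the diameters of neighbouring elements. -/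
def neighborRatio (d : ℕ) (σ : ℝ) : ℝ := max σ ((2 * σ) ^ ⌈(4 * σ) ^ d⌉₊)

/-- Let `A k` collect the elements at `v` of diameter at most `(2σ)^k h_t'`. Unless `A k` is the
whole star, an edge at `v` leads to a new element, which belongs to `A (k + 1)`; so the star is
exhausted after at most as many steps as it has elements. -/
theorem ShapeRegular.hDiam_le_pow_card_star (hd : 2 ≤ d) {σ : ℝ} (hσ : M.ShapeRegular σ)
    (hint : v ∈ interior M.domain) (ht : t ∈ M.star v) (ht' : t' ∈ M.star v) :
    hDiam (simplex t) ≤ (2 * σ) ^ (M.star v).card * hDiam (simplex t') := by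
  classical
  have hσ1 := hσ.one_le_two_mul (by omega) (mem_star.1 ht).1
  have hh := hDiam_pos (by omega) (mem_star.1 ht').1
  let A : ℕ → Finset (Finset (Rd d)) := fun k => (M.star v).filter
    (fun u => hDiam (simplex u) ≤ (2 * σ) ^ k * hDiam (simplex t'))
  have hstep : ∀ k, k + 1 ≤ (A k).card ∨ A k = M.star v := by
    intro k
    induction k with
    | zero =>
      exact Or.inl (Finset.card_pos.2 ⟨t', Finset.mem_filter.2 ⟨ht', by simp⟩⟩)
    | succ k ih =>
      have hmono : A k ⊆ A (k + 1) := by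
        intro u hu
        rw [Finset.mem_filter] at hu ⊢
        refine ⟨hu.1, hu.2.trans ?_⟩
        have := pow_le_pow_right₀ hσ1 k.le_succ
        gcongr
      by_cases hk : A k = M.star v
      · exact Or.inr (Finset.Subset.antisymm (Finset.filter_subset _ _) (hk.symm.subset.trans hmono))
      left
      have hcard := ih.resolve_right hk
      obtain ⟨a, ha, b, hb, hbA, w, hwv, hwa, hwb⟩ := exists_common_edge hd hint
        (Finset.filter_subset _ _) (Finset.card_pos.1 (by omega : 0 < (A k).card)) hk
      have hb' : b ∈ A (k + 1) := by
        refine Finset.mem_filter.2 ⟨hb, ?_⟩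
        have h1 := hσ.hDiam_le_of_common_edge (by omega) (mem_star.1 hb).1 hwv hwb
          (mem_star.1 hb).2 hwa (mem_star.1 (Finset.mem_filter.1 ha).1).2
        calc _ ≤ _ := h1
          _ ≤ 2 * σ * ((2 * σ) ^ k * hDiam (simplex t')) := by
            gcongr
            exact (Finset.mem_filter.1 ha).2
          _ = _ := by ring
      have := Finset.card_lt_card (Finset.ssubset_iff_subset_ne.2
        ⟨hmono, fun h => hbA (h.symm.subset hb')⟩)
      omega
  have hall : A (M.star v).card = M.star v := by
    refine (hstep _).resolve_left fun h => ?_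
    have := Finset.card_le_card (Finset.filter_subset
      (fun u => hDiam (simplex u) ≤ (2 * σ) ^ (M.star v).card * hDiam (simplex t')) (M.star v))
    exact absurd (h.trans this) (by omega)
  exact (Finset.mem_filter.1 (hall.symm.subset ht)).2

/-- Local quasi-uniformity at interior vertices. -/
theorem ShapeRegular.hDiam_le_neighborRatio_mul (hd : 1 ≤ d) {σ : ℝ} (hσ : M.ShapeRegular σ)
    (hint : v ∈ interior M.domain) (ht : t ∈ M.star v) (ht' : t' ∈ M.star v) :
    hDiam (simplex t) ≤ neighborRatio d σ * hDiam (simplex t') := by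
  have hh := hDiam_pos hd (mem_star.1 ht').1
  obtain ⟨hte, htv⟩ := mem_star.1 ht
  obtain ⟨hte', htv'⟩ := mem_star.1 ht'
  rcases hd.eq_or_lt with h1 | h2
  · refine (hσ.locally_quasiuniform_of_one h1.symm t hte t' hte'
      ⟨v, mem_simplex_of_mem htv, mem_simplex_of_mem htv'⟩).trans ?_
    gcongr
    exact le_max_left _ _
  · refine (hσ.hDiam_le_pow_card_star h2 hint ht ht').trans ?_
    gcongr
    refine le_trans (pow_le_pow_right₀ (hσ.one_le_two_mul hd hte) ?_) (le_max_right _ _)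
    have hcard := (hσ.card_star_le hd v).resolve_right (Finset.ne_empty_of_mem ht)
    exact_mod_cast hcard.trans (Nat.le_ceil _)

/-! ### Distance from an element to the complement of its patch -/

/-- The distance of an element in the interior of the domain to the complement of its patch is
bounded below by a multiple of its diameter. -/
theorem ShapeRegular.hDiam_le_mul_dist (hd : 1 ≤ d) {σ : ℝ} (hσ : M.ShapeRegular σ)
    (ht : t ∈ M.elements) (hint : simplex t ⊆ interior M.domain) {x y : Rd d}
    (hx : x ∈ simplex t) (hy : y ∉ M.patch t) :
    hDiam (simplex t) ≤ (d + 1) * (2 * σ * neighborRatio d σ) * dist x y := by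
  classical
  obtain ⟨⟨v, hv⟩, hvx⟩ : ∃ i : t, 1 / ((d : ℝ) + 1) ≤ (basis ht).coord i x := by
    by_contra! hcon
    have hne : (Finset.univ : Finset t).Nonempty := by
      obtain ⟨w, hw⟩ := Finset.card_pos.1 (by rw [card_of_mem_elements ht]; omega : 0 < t.card)
      exact ⟨⟨w, hw⟩, Finset.mem_univ _⟩
    have := Finset.sum_lt_sum_of_nonempty hne (fun i _ => hcon i)
    rw [(basis ht).sum_coord_apply_eq_one x, Finset.sum_const, Finset.card_univ, Fintype.card_coe,
      card_of_mem_elements ht, nsmul_eq_mul] at this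
    push_cast at this
    rw [mul_one_div_cancel (by positivity)] at this
    exact lt_irrefl _ this
  have hvint := hint (mem_simplex_of_mem hv)
  have hts : t ∈ M.star v := mem_star.2 ⟨ht, hv⟩
  obtain ⟨r, hr, hball⟩ := exists_ball_subset_star ht hv hvint
  have hσ0 := (hσ.exists_closedBall_subset hd ht).1
  have hh := hDiam_pos hd ht
  have hΛ : 0 < neighborRatio d σ := hσ0.trans_le (le_max_left _ _)
  -- The segment from `x` to `y` may leave the star of `v`. Contracting towards `v` by `ε` moves it
  -- into a ball inside the star and scales both its length and the coordinate gap by `ε`, which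
  -- cancels at the end.
  obtain ⟨ε, hε, hε1, hεx, hεy⟩ : ∃ ε : ℝ, 0 < ε ∧ ε ≤ 1 ∧ ε * dist v x < r ∧
      ε * dist v y < r := by
    have hD : 0 < 1 + dist v x + dist v y := by positivity
    refine ⟨min 1 (r / (1 + dist v x + dist v y)), by positivity, min_le_left _ _, ?_, ?_⟩ <;>
    · refine lt_of_le_of_lt (mul_le_mul_of_nonneg_right (min_le_right _ _) dist_nonneg) ?_
      rw [div_mul_eq_mul_div, div_lt_iff₀ hD]
      gcongr
      have := dist_nonneg (x := v) (y := x)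
      have := dist_nonneg (x := v) (y := y)
      linarith
  set x' : Rd d := AffineMap.lineMap v x ε with hx'
  set y' : Rd d := AffineMap.lineMap v y ε with hy'
  have hx'b : x' ∈ Metric.ball v r := by
    rw [Metric.mem_ball, hx', dist_lineMap_left, Real.norm_of_nonneg hε.le]
    exact hεx
  have hy'b : y' ∈ Metric.ball v r := by
    rw [Metric.mem_ball, hy', dist_lineMap_left, Real.norm_of_nonneg hε.le]
    exact hεy
  have hx't : x' ∈ simplex t :=
    (convex_convexHull ℝ _).lineMap_mem (mem_simplex_of_mem hv) hx ⟨hε.le, hε1⟩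
  have hxy' : ‖x' - y'‖ = ε * dist x y := by
    rw [hx', hy', AffineMap.lineMap_apply, AffineMap.lineMap_apply]
    simp only [vsub_eq_sub, vadd_eq_add]
    rw [show ε • (x - v) + v - (ε • (y - v) + v) = ε • (x - y) by module, norm_smul,
      Real.norm_of_nonneg hε.le, dist_eq_norm]
  obtain ⟨u, hu, hy'u⟩ := mem_iUnion₂.1 (hball hy'b)
  obtain ⟨hue, huv⟩ := mem_star.1 hu
  have hline : ∀ {u : Finset (Rd d)} (hu : u ∈ M.elements) (huv : v ∈ u) (z : Rd d) (i : u),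
      (basis hu).coord i (AffineMap.lineMap v z ε) =
        (1 - ε) * (if i = ⟨v, huv⟩ then 1 else 0) + ε * (basis hu).coord i z := by
    intro u hu huv z i
    rw [← coord_vertex hu i ⟨v, huv⟩, AffineMap.apply_lineMap, AffineMap.lineMap_apply]
    simp only [vsub_eq_sub, vadd_eq_add, smul_eq_mul]
    ring
  -- Otherwise undoing the contraction leaves all coordinates in `u` nonnegative, so `y` lies in `u`
  -- and in the patch.
  have hyu : (basis hue).coord ⟨v, huv⟩ y' < 1 - ε := by
    by_contra! hcon
    refine hy (mem_iUnion₂.2 ⟨u, hue, mem_iUnion.2 ⟨⟨v, mem_simplex_of_mem huv,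
      mem_simplex_of_mem hv⟩, ?_⟩⟩)
    rw [simplex_eq_nonneg_coord hue]
    intro i
    have h1 := hline hue huv y i
    have h2 := coord_nonneg hue hy'u i
    refine nonneg_of_mul_nonneg_right (a := ε) ?_ hε
    by_cases hi : i = ⟨v, huv⟩
    · subst hi
      rw [if_pos rfl] at h1
      linarith
    · rw [if_neg hi] at h1
      linarith
  have hxt : (basis ht).coord ⟨v, hv⟩ x' = 1 - ε + ε * (basis ht).coord ⟨v, hv⟩ x := by
    rw [hx', hline ht hv x, if_pos rfl, mul_one]
  let γ : ℝ → Rd d := AffineMap.lineMap x' y'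
  have hγ : Continuous γ := AffineMap.lineMap_continuous
  set L : ℝ := 2 * σ * neighborRatio d σ / hDiam (simplex t) * ‖x' - y'‖ with hL
  -- The hat function of `v` along the segment is patched from coordinates of the elements at `v`;
  -- `L` bounds all slopes, with diameters replaced by that of `t` via `neighborRatio`.
  have hchain := sub_le_mul_sub_of_closed_cover (ι := M.star v)
    (C := fun u => γ ⁻¹' simplex u.1) (fun u => (isCompact_simplex u.1).isClosed.preimage hγ)
    (f := fun u τ => (basis (mem_star.1 u.2).1).coord ⟨v, (mem_star.1 u.2).2⟩ (γ τ)) (L := L)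
    (fun i j τ hi hj => coord_eq_coord _ _ _ _ hi hj) ?_ Finset.univ (a := 0) (b := 1)
    (i := ⟨t, hts⟩) (j := ⟨u, hu⟩) zero_le_one (Finset.mem_univ _) ?_ ?_ ?_
  · simp only [γ, AffineMap.lineMap_apply_zero, AffineMap.lineMap_apply_one, sub_zero,
      mul_one] at hchain
    have h1 : ε * (1 / ((d : ℝ) + 1)) ≤ L := by
      have := mul_le_mul_of_nonneg_left hvx hε.le
      linarith
    rw [hL, hxy', mul_one_div, div_mul_eq_mul_div, div_le_div_iff₀ (by positivity) hh] at h1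
    refine le_of_mul_le_mul_left (a := ε) ?_ hε
    linarith
  · intro i τ _ τ' _ hττ'
    have h1 := hσ.hDiam_mul_abs_coord_sub_le hd (mem_star.1 i.2).1 ⟨v, (mem_star.1 i.2).2⟩
      (γ τ) (γ τ')
    have h2 := hσ.hDiam_le_neighborRatio_mul hd hvint hts i.2
    have h3 : ‖γ τ - γ τ'‖ = (τ' - τ) * ‖x' - y'‖ := by
      rw [← dist_eq_norm, dist_lineMap_lineMap, Real.dist_eq, abs_sub_comm,
        abs_of_nonneg (by linarith), dist_eq_norm]
    rw [h3] at h1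
    refine (le_abs_self _).trans ?_
    rw [hL, div_mul_eq_mul_div, div_mul_eq_mul_div, le_div_iff₀ hh]
    set D := |(basis (mem_star.1 i.2).1).coord ⟨v, (mem_star.1 i.2).2⟩ (γ τ) -
      (basis (mem_star.1 i.2).1).coord ⟨v, (mem_star.1 i.2).2⟩ (γ τ')|
    calc D * hDiam (simplex t) ≤ D * (neighborRatio d σ * hDiam (simplex i.1)) := by gcongr
      _ = neighborRatio d σ * (hDiam (simplex i.1) * D) := by ring
      _ ≤ neighborRatio d σ * (2 * σ * ((τ' - τ) * ‖x' - y'‖)) := by gcongr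
      _ = _ := by ring
  · simpa [γ] using hx't
  · simpa [γ] using hy'u
  · intro τ hτ
    have hmem : γ τ ∈ Metric.ball v r := (convex_ball v r).lineMap_mem hx'b hy'b hτ
    obtain ⟨w, hw, hγw⟩ := mem_iUnion₂.1 (hball hmem)
    exact mem_iUnion₂.2 ⟨⟨w, hw⟩, Finset.mem_univ _, hγw⟩

end SimplicialMesh

/-! ### The fractional kernel and its tail -/

/-- The kernel `|x - y|^{-(d+2s)}`. -/
def fracKernel {d : ℕ} (s : ℝ) (x y : Rd d) : ℝ≥0∞ :=
  ENNReal.ofReal (1 / ‖x - y‖ ^ ((d : ℝ) + 2 * s))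

theorem fracKernel_comm (s : ℝ) (x y : Rd d) : fracKernel s x y = fracKernel s y x := by
  rw [fracKernel, fracKernel, norm_sub_rev]

theorem measurable_fracKernel (s : ℝ) :
    Measurable fun p : Rd d × Rd d => fracKernel s p.1 p.2 := by
  unfold fracKernel
  fun_prop

theorem measurable_fracKernel_right (s : ℝ) (x : Rd d) : Measurable (fracKernel s x) :=
  Measurable.of_uncurry_left (f := fracKernel s) (measurable_fracKernel s)

/-- The kernel `|x - y|^{-(d+2s)}` truncated to `|x - y| ≥ R`. -/
def truncKernel {d : ℕ} (s R : ℝ) (x y : Rd d) : ℝ≥0∞ :=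
  {z : Rd d | R ≤ ‖z‖}.indicator (fun z => ENNReal.ofReal (1 / ‖z‖ ^ ((d : ℝ) + 2 * s))) (x - y)

theorem truncKernel_comm (s R : ℝ) (x y : Rd d) : truncKernel s R x y = truncKernel s R y x := by
  simp only [truncKernel, indicator, mem_ofPred_eq, norm_sub_rev x y]

theorem measurable_truncKernel (s R : ℝ) :
    Measurable fun p : Rd d × Rd d => truncKernel s R p.1 p.2 := by
  have h : Measurable fun z : Rd d => {z : Rd d | R ≤ ‖z‖}.indicator
      (fun z => ENNReal.ofReal (1 / ‖z‖ ^ ((d : ℝ) + 2 * s))) z :=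
    Measurable.indicator (by fun_prop) (measurableSet_le measurable_const measurable_norm)
  exact h.comp (measurable_fst.sub measurable_snd)

theorem measurable_truncKernel_right (s R : ℝ) (x : Rd d) : Measurable (truncKernel s R x) :=
  Measurable.of_uncurry_left (f := truncKernel s R) (measurable_truncKernel s R)

theorem fracKernel_le_truncKernel {s R : ℝ} {x y : Rd d} (h : R ≤ ‖x - y‖) :
    fracKernel s x y ≤ truncKernel s R x y := by
  rw [truncKernel, indicator_of_mem (by exact h), fracKernel]

/-- The tail integral of the fractional kernel scales like `R^{-2s}`. -/
theorem exists_lintegral_truncKernel_le (d : ℕ) {s : ℝ} (hs : 0 < s) :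
    ∃ K : ℝ≥0∞, K < ∞ ∧ ∀ R : ℝ, 0 < R → ∀ x : Rd d,
      ∫⁻ y, truncKernel s R x y ≤ K * ENNReal.ofReal ((R ^ (2 * s))⁻¹) := by
  set r : ℝ := (d : ℝ) + 2 * s with hr
  have hr0 : 0 < r := by positivity
  set I : ℝ≥0∞ := ∫⁻ z : Rd d, ENNReal.ofReal ((1 + ‖z‖) ^ (-r)) with hI
  have hIfin : I < ∞ := finite_integral_one_add_norm (by simp [hr, hs])
  refine ⟨ENNReal.ofReal (2 ^ r) * I, ENNReal.mul_lt_top ENNReal.ofReal_lt_top hIfin, ?_⟩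
  intro R hR x
  have hscale : ∫⁻ z : Rd d, ENNReal.ofReal ((1 + ‖R⁻¹ • z‖) ^ (-r)) =
      ENNReal.ofReal (R ^ d) * I := by
    have h := lintegral_map (μ := (volume : Measure (Rd d)))
      (f := fun z : Rd d => ENNReal.ofReal ((1 + ‖z‖) ^ (-r))) (g := (R⁻¹ • ·)) (by fun_prop)
      (by fun_prop)
    rw [← h, Measure.map_addHaar_smul _ (inv_ne_zero hR.ne'), lintegral_smul_measure,
      finrank_euclideanSpace, Fintype.card_fin, inv_pow, inv_inv, abs_of_pos (by positivity),
      smul_eq_mul]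
  -- Where `‖z‖ ≥ R`, one has `1 + ‖z‖ / R ≤ 2 ‖z‖ / R`; this gives the factor `2 ^ r`.
  have hpt : ∀ z : Rd d, {z : Rd d | R ≤ ‖z‖}.indicator
      (fun z => ENNReal.ofReal (1 / ‖z‖ ^ r)) z ≤
      ENNReal.ofReal (2 ^ r * R ^ (-r)) * ENNReal.ofReal ((1 + ‖R⁻¹ • z‖) ^ (-r)) := by
    intro z
    by_cases hz : R ≤ ‖z‖
    · rw [indicator_of_mem (by exact hz), ← ENNReal.ofReal_mul (by positivity)]
      refine ENNReal.ofReal_le_ofReal ?_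
      have hz0 : 0 < ‖z‖ := hR.trans_le hz
      have h1 : 1 + ‖R⁻¹ • z‖ ≤ 2 * ‖z‖ / R := by
        rw [norm_smul, Real.norm_of_nonneg (by positivity), le_div_iff₀ hR]
        field_simp
        linarith
      have h2 : (2 * ‖z‖ / R) ^ (-r) ≤ (1 + ‖R⁻¹ • z‖) ^ (-r) :=
        Real.rpow_le_rpow_of_nonpos (by positivity) h1 (by linarith)
      calc 1 / ‖z‖ ^ r = 2 ^ r * R ^ (-r) * (2 * ‖z‖ / R) ^ (-r) := by
            rw [Real.div_rpow (by positivity) hR.le, Real.mul_rpow (by norm_num) hz0.le,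
              Real.rpow_neg hR.le, Real.rpow_neg hz0.le, Real.rpow_neg (by norm_num)]
            field_simp
        _ ≤ _ := by gcongr
    · rw [indicator_of_notMem (by exact hz)]
      exact zero_le
  calc ∫⁻ y, truncKernel s R x y
      = ∫⁻ z : Rd d, {z : Rd d | R ≤ ‖z‖}.indicator
          (fun z => ENNReal.ofReal (1 / ‖z‖ ^ r)) z :=
        lintegral_sub_left_eq_self (fun z : Rd d => {z : Rd d | R ≤ ‖z‖}.indicator
          (fun z => ENNReal.ofReal (1 / ‖z‖ ^ r)) z) x
    _ ≤ ∫⁻ z : Rd d, ENNReal.ofReal (2 ^ r * R ^ (-r)) *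
          ENNReal.ofReal ((1 + ‖R⁻¹ • z‖) ^ (-r)) := lintegral_mono hpt
    _ = ENNReal.ofReal (2 ^ r * R ^ (-r)) * (ENNReal.ofReal (R ^ d) * I) := by
        rw [lintegral_const_mul _ (by fun_prop), hscale]
    _ = ENNReal.ofReal (2 ^ r) * I * ENNReal.ofReal ((R ^ (2 * s))⁻¹) := by
        have : R ^ (-r) * R ^ d = (R ^ (2 * s))⁻¹ := by
          rw [← Real.rpow_natCast, ← Real.rpow_add hR, ← Real.rpow_neg hR.le]
          congr 1
          rw [hr]; ring
        rw [← this, ENNReal.ofReal_mul (by positivity), ENNReal.ofReal_mul (by positivity)]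
        ring

/-! ### Reductions for the Gagliardo integral -/

theorem gagliardo_congr_ae (s : ℝ) (A B : Set (Rd d)) {w w' : Rd d → ℝ} (h : w =ᵐ[volume] w') :
    gagliardo s A B w = gagliardo s A B w' := by
  refine lintegral_congr_ae ?_
  filter_upwards [ae_restrict_of_ae h] with x hx
  refine lintegral_congr_ae ?_
  filter_upwards [ae_restrict_of_ae h] with y hy
  rw [hx, hy]

theorem measurable_gagliardo_integrand (s : ℝ) {w : Rd d → ℝ} (hw : Measurable w) :
    Measurable fun p : Rd d × Rd d =>
      ENNReal.ofReal (|w p.1 - w p.2| ^ 2 / ‖p.1 - p.2‖ ^ ((d : ℝ) + 2 * s)) := by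
  have h1 : Measurable fun p : Rd d × Rd d => |w p.1 - w p.2| ^ 2 := by fun_prop
  have h2 : Measurable fun p : Rd d × Rd d => ‖p.1 - p.2‖ ^ ((d : ℝ) + 2 * s) := by fun_prop
  exact (h1.div h2).ennreal_ofReal

/-- For a function supported in `A` it suffices to integrate over `A × ℝᵈ`. -/
theorem gagliardo_univ_le (s : ℝ) {A : Set (Rd d)} (hA : MeasurableSet A) {w : Rd d → ℝ}
    (hw : Measurable w) (h0 : ∀ x ∉ A, w x = 0) :
    gagliardo s univ univ w ≤ 2 * gagliardo s A univ w := by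
  have hm := measurable_gagliardo_integrand s hw
  set k : Rd d → Rd d → ℝ≥0∞ := fun x y =>
    ENNReal.ofReal (|w x - w y| ^ 2 / ‖x - y‖ ^ ((d : ℝ) + 2 * s)) with hk
  have hsymm : ∀ x y, k x y = k y x := fun x y => by
    simp only [hk]
    rw [abs_sub_comm, norm_sub_rev]
  -- The integrand vanishes on `Aᶜ × Aᶜ`, and `Aᶜ × A` is the mirror image of a part of `A × ℝᵈ`.
  have hcompl : ∫⁻ x in Aᶜ, ∫⁻ y, k x y ≤ ∫⁻ x in A, ∫⁻ y, k x y := by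
    calc ∫⁻ x in Aᶜ, ∫⁻ y, k x y = ∫⁻ x in Aᶜ, ∫⁻ y in A, k x y := by
          refine setLIntegral_congr_fun hA.compl fun x hx => ?_
          refine (setLIntegral_eq_of_support_subset fun y hy => ?_).symm
          by_contra hyA
          exact hy (by simp [hk, h0 x hx, h0 y hyA])
      _ = ∫⁻ y in A, ∫⁻ x in Aᶜ, k x y := lintegral_lintegral_swap hm.aemeasurable
      _ ≤ ∫⁻ y in A, ∫⁻ x, k y x := by
          refine lintegral_mono fun y => ?_
          simp_rw [hsymm y]
          exact setLIntegral_le_lintegral _ _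
  have hsum := lintegral_add_compl (μ := (volume : Measure (Rd d))) (fun x => ∫⁻ y, k x y) hA
  simp only [gagliardo, Measure.restrict_univ]
  change ∫⁻ x, ∫⁻ y, k x y ≤ 2 * ∫⁻ x in A, ∫⁻ y, k x y
  rw [← hsum, two_mul]
  gcongr

theorem gagliardo_integrand_le (s : ℝ) (w : Rd d → ℝ) (x y : Rd d) :
    ENNReal.ofReal (|w x - w y| ^ 2 / ‖x - y‖ ^ ((d : ℝ) + 2 * s)) ≤
      2 * (‖w x‖ₑ ^ 2 + ‖w y‖ₑ ^ 2) * fracKernel s x y := by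
  have hsq : ∀ a : ℝ, ‖a‖ₑ ^ 2 = ENNReal.ofReal (a ^ 2) := fun a => by
    rw [← sq_abs, ENNReal.ofReal_pow (abs_nonneg a), ← Real.norm_eq_abs, ofReal_norm]
  have htwo : ∀ a : ℝ, 2 * ENNReal.ofReal a = ENNReal.ofReal (2 * a) := fun a => by
    rw [ENNReal.ofReal_mul two_pos.le, ENNReal.ofReal_ofNat]
  rw [fracKernel, hsq, hsq, ← ENNReal.ofReal_add (sq_nonneg _) (sq_nonneg _), htwo,
    ← ENNReal.ofReal_mul (by positivity), mul_one_div]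
  refine ENNReal.ofReal_le_ofReal ?_
  gcongr
  rw [sq_abs]
  nlinarith [sq_nonneg (w x + w y)]

theorem eLpNorm_two_sq (w : Rd d → ℝ) (μ : Measure (Rd d)) :
    eLpNorm w 2 μ ^ 2 = ∫⁻ x, ‖w x‖ₑ ^ 2 ∂μ := by
  have h := eLpNorm_nnreal_pow_eq_lintegral (μ := μ) (f := w) (p := 2) two_ne_zero
  simpa using h

/-! ### Integration over fitted meshes -/

namespace SimplicialMesh

variable {M : SimplicialMesh d} {t t' : Finset (Rd d)} {Ω : Set (Rd d)}

theorem mem_elements_of_mem_elementsMeeting (ht : t ∈ M.elementsMeeting Ω) : t ∈ M.elements := by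
  classical
  simp only [elementsMeeting, Finset.mem_filter] at ht
  exact ht.1

theorem measurableSet_simplex (t : Finset (Rd d)) : MeasurableSet (simplex t) :=
  (isCompact_simplex t).isClosed.measurableSet

theorem measurableSet_patch (M : SimplicialMesh d) (t : Finset (Rd d)) :
    MeasurableSet (M.patch t) :=
  M.elements.measurableSet_biUnion fun u _ => MeasurableSet.iUnion fun _ => measurableSet_simplex u

theorem FittedTo.simplex_subset_interior (h : M.FittedTo Ω) (ht : t ∈ M.elementsMeeting Ω) :
    simplex t ⊆ interior M.domain :=
  (subset_biUnion_of_mem (u := fun t => simplex t) ht).trans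
    (h.iUnion_elementsMeeting.subset.trans h.closure_subset_interior)

theorem FittedTo.lintegral_closure (h : M.FittedTo Ω) (f : Rd d → ℝ≥0∞) :
    ∫⁻ x in closure Ω, f x = ∑ t ∈ M.elementsMeeting Ω, ∫⁻ x in simplex t, f x := by
  rw [← h.iUnion_elementsMeeting]
  exact lintegral_biUnion_finset₀ (fun t ht t' ht' hne => volume_inter_eq_zero
    (mem_elements_of_mem_elementsMeeting ht) (mem_elements_of_mem_elementsMeeting ht') hne)
    (fun t _ => (measurableSet_simplex t).nullMeasurableSet) f

theorem subset_patch (ht' : t' ∈ M.elements) (h : (simplex t' ∩ simplex t).Nonempty) :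
    simplex t' ⊆ M.patch t := fun _ hy => mem_iUnion₂.2 ⟨t', ht', mem_iUnion.2 ⟨h, hy⟩⟩

/-- Almost every point of an element belongs to no other element. -/
theorem ae_notMem_of_ne (ht : t ∈ M.elements) :
    ∀ᵐ x ∂(volume.restrict (simplex t)), ∀ u ∈ M.elements, u ≠ t → x ∉ simplex u := by
  have h : ∀ u ∈ M.elements, ∀ᵐ x ∂(volume.restrict (simplex t)), u ≠ t → x ∉ simplex u := by
    intro u hu
    by_cases hut : u = t
    · exact Filter.Eventually.of_forall fun x h => absurd hut h
    · rw [ae_restrict_iff' (measurableSet_simplex t)]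
      filter_upwards [measure_eq_zero_iff_ae_notMem.1
        (volume_inter_eq_zero ht hu (Ne.symm hut))] with x hx hxt _ hxu
      exact hx ⟨hxt, hxu⟩
  exact (Filter.eventually_all_finset M.elements).2 h

/-- The only element containing `x` is `t`, and meeting is symmetric: `x` in the patch of `t'` would
put `t'`, and with it `y`, in the patch of `t`. -/
theorem notMem_patch_of_notMem (ht : t ∈ M.elements) (ht' : t' ∈ M.elements) {x y : Rd d}
    (hx : ∀ u ∈ M.elements, u ≠ t → x ∉ simplex u) (hy' : y ∈ simplex t') (hy : y ∉ M.patch t) :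
    x ∉ M.patch t' := by
  intro hcon
  obtain ⟨u, hu, hux⟩ := mem_iUnion₂.1 hcon
  obtain ⟨hne, hxu⟩ := mem_iUnion.1 hux
  by_cases hut : u = t
  · subst hut
    exact hy (subset_patch ht' (by rwa [inter_comm]) hy')
  · exact hx u hu hut hxu

end SimplicialMesh

/-! ### Far field estimate and localization -/

namespace SimplicialMesh

variable {M : SimplicialMesh d} {t t' : Finset (Rd d)} {Ω : Set (Rd d)}

/-- The constant `κ` such that points outside the patch of an interior element `T` have distance
at least `h_T / κ` to `T`. -/
def patchRatio (d : ℕ) (σ : ℝ) : ℝ := max 1 ((d + 1) * (2 * σ * neighborRatio d σ))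

/-- The maximum with 1 gives positivity for every real `σ`, with no mesh at hand. -/
theorem patchRatio_pos (d : ℕ) (σ : ℝ) : 0 < patchRatio d σ :=
  one_pos.trans_le (le_max_left _ _)

theorem ShapeRegular.fracKernel_le_truncKernel (hd : 1 ≤ d) {σ : ℝ} (hσ : M.ShapeRegular σ)
    (hfit : M.FittedTo Ω) (ht : t ∈ M.elementsMeeting Ω) (s : ℝ) {x y : Rd d}
    (hx : x ∈ simplex t) (hy : y ∉ M.patch t) :
    fracKernel s x y ≤
      truncKernel s (hDiam (simplex t) / patchRatio d σ) x y := by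
  have h := hσ.hDiam_le_mul_dist hd (mem_elements_of_mem_elementsMeeting ht)
    (hfit.simplex_subset_interior ht) hx hy
  have h' : hDiam (simplex t) / patchRatio d σ ≤ ‖x - y‖ := by
    rw [div_le_iff₀' (patchRatio_pos d σ), ← dist_eq_norm]
    refine h.trans ?_
    gcongr
    exact le_max_right _ _
  exact FracLoc.fracKernel_le_truncKernel h'

theorem gagliardo_le_add (s : ℝ) (A B : Set (Rd d)) {w : Rd d → ℝ} (hw : Measurable w) :
    gagliardo s A B w ≤ 2 * (∫⁻ x in A, ‖w x‖ₑ ^ 2 * ∫⁻ y in B, fracKernel s x y) +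
      2 * ∫⁻ x in A, ∫⁻ y in B, ‖w y‖ₑ ^ 2 * fracKernel s x y := by
  have hQ : Measurable fun x => ‖w x‖ₑ ^ 2 := by fun_prop
  have hk := measurable_fracKernel (d := d) s
  have hkx := measurable_fracKernel_right (d := d) s
  have hm1 : Measurable fun x => ‖w x‖ₑ ^ 2 * ∫⁻ y in B, fracKernel s x y :=
    hQ.mul hk.lintegral_prod_right'
  have hm2 : Measurable fun x => ∫⁻ y in B, ‖w y‖ₑ ^ 2 * fracKernel s x y :=
    ((hQ.comp measurable_snd).mul hk).lintegral_prod_right'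
  rw [← lintegral_const_mul _ hm1, ← lintegral_const_mul _ hm2,
    ← lintegral_add_left (hm1.const_mul _)]
  refine lintegral_mono fun x => ?_
  have hm3 : Measurable fun y => ‖w y‖ₑ ^ 2 * fracKernel s x y := hQ.mul (hkx x)
  have heq : 2 * (‖w x‖ₑ ^ 2 * ∫⁻ y in B, fracKernel s x y) +
      2 * ∫⁻ y in B, ‖w y‖ₑ ^ 2 * fracKernel s x y =
      ∫⁻ y in B, 2 * (‖w x‖ₑ ^ 2 + ‖w y‖ₑ ^ 2) * fracKernel s x y := by
    rw [← mul_assoc, ← lintegral_const_mul _ (hkx x), ← lintegral_const_mul _ hm3,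
      ← lintegral_add_left ((hkx x).const_mul _)]
    refine lintegral_congr fun y => ?_
    ring
  exact (lintegral_mono fun y => gagliardo_integrand_le s w x y).trans_eq heq.symm

theorem ShapeRegular.lintegral_compl_patch_le (hd : 1 ≤ d) {σ : ℝ} (hσ : M.ShapeRegular σ)
    (hfit : M.FittedTo Ω) (ht : t ∈ M.elementsMeeting Ω) (s : ℝ) {x : Rd d}
    (hx : x ∈ simplex t) :
    ∫⁻ y in (M.patch t)ᶜ, fracKernel s x y ≤
      ∫⁻ y, truncKernel s (hDiam (simplex t) / patchRatio d σ) x y :=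
  (setLIntegral_mono (measurable_truncKernel_right s _ _)
    fun _ hy => hσ.fracKernel_le_truncKernel hd hfit ht s hx hy).trans (setLIntegral_le_lintegral _ _)

/-- For almost every `x` in an element the far field of `Q` at `x` is a sum of truncated
potentials. -/
theorem ShapeRegular.lintegral_far_le (hd : 1 ≤ d) {σ : ℝ} (hσ : M.ShapeRegular σ)
    (hfit : M.FittedTo Ω) (ht : t ∈ M.elementsMeeting Ω) (s : ℝ) {Q : Rd d → ℝ≥0∞}
    (hQ : Measurable Q) (h0 : ∀ x ∉ closure Ω, Q x = 0) {x : Rd d}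
    (hx : ∀ u ∈ M.elements, u ≠ t → x ∉ simplex u) :
    ∫⁻ y in (M.patch t)ᶜ, Q y * fracKernel s x y ≤
      ∑ u ∈ M.elementsMeeting Ω, ∫⁻ y in simplex u,
        Q y * truncKernel s (hDiam (simplex u) / patchRatio d σ) x y := by
  have hP := (measurableSet_patch M t).compl
  rw [← lintegral_indicator hP, ← setLIntegral_eq_of_support_subset (s := closure Ω),
    hfit.lintegral_closure]
  · refine Finset.sum_le_sum fun u hu => setLIntegral_mono
      (hQ.mul (measurable_truncKernel_right s _ _)) fun y hy => ?_
    by_cases hyP : y ∈ M.patch t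
    · rw [indicator_of_notMem (by simpa using hyP)]
      exact zero_le
    -- The roles of `x` and `y` are exchanged, so that the truncation radius comes from the element
    -- containing `y`.
    · rw [indicator_of_mem hyP, truncKernel_comm, fracKernel_comm]
      gcongr
      exact hσ.fracKernel_le_truncKernel hd hfit hu s hy (notMem_patch_of_notMem
        (mem_elements_of_mem_elementsMeeting ht) (mem_elements_of_mem_elementsMeeting hu) hx hy hyP)
  · intro y hy
    by_contra hyΩ
    exact hy (by simp [indicator, h0 y hyΩ])

/-- The pointwise bound no longer depends on the element containing `x`, so the sum over `t` becomes
one integral, enlarged to all of space. Fubini then leaves a kernel tail for each `y`. -/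
theorem ShapeRegular.sum_lintegral_far_le (hd : 1 ≤ d) {σ : ℝ} (hσ : M.ShapeRegular σ)
    (hfit : M.FittedTo Ω) {s : ℝ} {K : ℝ≥0∞}
    (hK : ∀ R : ℝ, 0 < R → ∀ x : Rd d,
      ∫⁻ y, truncKernel s R x y ≤ K * ENNReal.ofReal ((R ^ (2 * s))⁻¹))
    {Q : Rd d → ℝ≥0∞} (hQ : Measurable Q) (h0 : ∀ x ∉ closure Ω, Q x = 0) :
    ∑ t ∈ M.elementsMeeting Ω, ∫⁻ x in simplex t, ∫⁻ y in (M.patch t)ᶜ,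
        Q y * fracKernel s x y ≤
      ∑ t ∈ M.elementsMeeting Ω, (∫⁻ x in simplex t, Q x) *
        (K * ENNReal.ofReal (((hDiam (simplex t) / patchRatio d σ) ^ (2 * s))⁻¹)) := by
  set F : Rd d → ℝ≥0∞ := fun x => ∑ u ∈ M.elementsMeeting Ω, ∫⁻ y in simplex u,
    Q y * truncKernel s (hDiam (simplex u) / patchRatio d σ) x y
  have hFm : ∀ R, Measurable fun p : Rd d × Rd d => Q p.2 * truncKernel s R p.1 p.2 :=
    fun R => (hQ.comp measurable_snd).mul (measurable_truncKernel s R)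
  calc _ ≤ ∑ t ∈ M.elementsMeeting Ω, ∫⁻ x in simplex t, F x := by
        refine Finset.sum_le_sum fun t ht => lintegral_mono_ae ?_
        filter_upwards [ae_notMem_of_ne (mem_elements_of_mem_elementsMeeting ht)] with x hx
        exact hσ.lintegral_far_le hd hfit ht s hQ h0 hx
    _ = ∫⁻ x in closure Ω, F x := (hfit.lintegral_closure F).symm
    _ ≤ ∫⁻ x, F x := setLIntegral_le_lintegral _ _
    _ = ∑ u ∈ M.elementsMeeting Ω, ∫⁻ x, ∫⁻ y in simplex u,
          Q y * truncKernel s (hDiam (simplex u) / patchRatio d σ) x y :=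
        lintegral_finsetSum _ fun u _ => (hFm _).lintegral_prod_right'
    _ ≤ _ := by
        refine Finset.sum_le_sum fun u hu => ?_
        rw [lintegral_lintegral_swap (hFm _).aemeasurable, ← lintegral_mul_const _ hQ]
        refine lintegral_mono fun y => ?_
        simp_rw [truncKernel_comm s _ _ y]
        rw [lintegral_const_mul _ (measurable_truncKernel_right s _ _)]
        gcongr
        exact hK _ (div_pos (hDiam_pos hd (mem_elements_of_mem_elementsMeeting hu))
          (patchRatio_pos d σ)) y

/-- The contribution of the far field to the Gagliardo seminorm is bounded by weighted
`L²`-norms. -/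
theorem ShapeRegular.sum_gagliardo_compl_patch_le (hd : 1 ≤ d) {σ : ℝ} (hσ : M.ShapeRegular σ)
    (hfit : M.FittedTo Ω) {s : ℝ} {K : ℝ≥0∞}
    (hK : ∀ R : ℝ, 0 < R → ∀ x : Rd d,
      ∫⁻ y, truncKernel s R x y ≤ K * ENNReal.ofReal ((R ^ (2 * s))⁻¹))
    {w : Rd d → ℝ} (hw : Measurable w) (h0 : ∀ x ∉ closure Ω, w x = 0) :
    ∑ t ∈ M.elementsMeeting Ω, gagliardo s (simplex t) (M.patch t)ᶜ w ≤
      4 * ∑ t ∈ M.elementsMeeting Ω, (∫⁻ x in simplex t, ‖w x‖ₑ ^ 2) *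
        (K * ENNReal.ofReal (((hDiam (simplex t) / patchRatio d σ) ^ (2 * s))⁻¹)) := by
  have hQm : Measurable fun x => ‖w x‖ₑ ^ 2 := by fun_prop
  have hfar := hσ.sum_lintegral_far_le hd hfit hK hQm (fun x hx => by simp [h0 x hx])
  have hnear : ∀ t ∈ M.elementsMeeting Ω, ∫⁻ x in simplex t, ‖w x‖ₑ ^ 2 *
        ∫⁻ y in (M.patch t)ᶜ, fracKernel s x y ≤
      (∫⁻ x in simplex t, ‖w x‖ₑ ^ 2) *
        (K * ENNReal.ofReal (((hDiam (simplex t) / patchRatio d σ) ^ (2 * s))⁻¹)) := by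
    intro t ht
    rw [← lintegral_mul_const _ hQm]
    refine setLIntegral_mono (hQm.mul_const _) fun x hx => ?_
    gcongr
    exact (hσ.lintegral_compl_patch_le hd hfit ht s hx).trans
      (hK _ (div_pos (hDiam_pos hd (mem_elements_of_mem_elementsMeeting ht))
        (patchRatio_pos d σ)) x)
  refine (Finset.sum_le_sum fun t _ => gagliardo_le_add s _ _ hw).trans ?_
  rw [Finset.sum_add_distrib, ← Finset.mul_sum, ← Finset.mul_sum]
  refine (add_le_add (mul_le_mul_right (Finset.sum_le_sum hnear) _)
    (mul_le_mul_right hfar _)).trans_eq ?_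
  ring

/-- Localization of the Gagliardo seminorm for measurable functions vanishing off `closure Ω`. -/
theorem ShapeRegular.gagliardo_univ_le_sum (hd : 1 ≤ d) {σ : ℝ} (hσ : M.ShapeRegular σ)
    (hfit : M.FittedTo Ω) {s : ℝ} {K : ℝ≥0∞}
    (hK : ∀ R : ℝ, 0 < R → ∀ x : Rd d,
      ∫⁻ y, truncKernel s R x y ≤ K * ENNReal.ofReal ((R ^ (2 * s))⁻¹))
    {w : Rd d → ℝ} (hw : Measurable w) (h0 : ∀ x ∉ closure Ω, w x = 0) :
    gagliardo s univ univ w ≤ (2 + 8 * (K * ENNReal.ofReal (patchRatio d σ ^ (2 * s)))) *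
      ∑ t ∈ M.elementsMeeting Ω, (gagliardo s (simplex t) (M.patch t) w +
        eLpNorm w 2 (volume.restrict (simplex t)) ^ 2 /
          ENNReal.ofReal (hDiam (simplex t) ^ (2 * s))) := by
  set E := M.elementsMeeting Ω
  set K' : ℝ≥0∞ := K * ENNReal.ofReal (patchRatio d σ ^ (2 * s)) with hK'
  have hfar := hσ.sum_gagliardo_compl_patch_le hd hfit hK hw h0
  have hweight : ∀ t ∈ E, (∫⁻ x in simplex t, ‖w x‖ₑ ^ 2) *
      (K * ENNReal.ofReal (((hDiam (simplex t) / patchRatio d σ) ^ (2 * s))⁻¹)) =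
      K' * (eLpNorm w 2 (volume.restrict (simplex t)) ^ 2 /
          ENNReal.ofReal (hDiam (simplex t) ^ (2 * s))) := by
    intro t ht
    have hh := hDiam_pos hd (mem_elements_of_mem_elementsMeeting ht)
    have hκ := patchRatio_pos d σ
    rw [eLpNorm_two_sq, Real.div_rpow hh.le hκ.le, inv_div, div_eq_mul_inv,
      ENNReal.ofReal_mul (by positivity), ENNReal.ofReal_inv_of_pos (by positivity), hK',
      div_eq_mul_inv]
    ring
  rw [Finset.sum_congr rfl hweight, ← Finset.mul_sum] at hfar
  have hsplit : gagliardo s (closure Ω) univ w = ∑ t ∈ E, gagliardo s (simplex t) (M.patch t) w +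
      ∑ t ∈ E, gagliardo s (simplex t) (M.patch t)ᶜ w := by
    rw [← Finset.sum_add_distrib, gagliardo, hfit.lintegral_closure]
    refine Finset.sum_congr rfl fun t _ => ?_
    have hm : Measurable fun x => ∫⁻ y in M.patch t,
        ENNReal.ofReal (|w x - w y| ^ 2 / ‖x - y‖ ^ ((d : ℝ) + 2 * s)) :=
      (measurable_gagliardo_integrand s hw).lintegral_prod_right'
    rw [gagliardo, gagliardo, ← lintegral_add_left hm]
    refine lintegral_congr fun x => ?_
    rw [lintegral_add_compl _ (measurableSet_patch M t), Measure.restrict_univ]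
  refine (gagliardo_univ_le s isClosed_closure.measurableSet hw h0).trans ?_
  rw [hsplit, Finset.sum_add_distrib]
  set G := ∑ t ∈ E, gagliardo s (simplex t) (M.patch t) w
  set N := ∑ t ∈ E, eLpNorm w 2 (volume.restrict (simplex t)) ^ 2 /
          ENNReal.ofReal (hDiam (simplex t) ^ (2 * s))
  calc 2 * (G + ∑ t ∈ E, gagliardo s (simplex t) (M.patch t)ᶜ w)
      ≤ 2 * (G + 4 * (K' * N)) := by gcongr
    -- The added terms complete the product `(2 + 8 K') (G + N)`.
    _ ≤ 2 * (G + 4 * (K' * N)) + (8 * K' * G + 2 * N) := le_self_add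
    _ = _ := by ring

end SimplicialMesh

/-! ### From measurable representatives to the theorem -/

theorem hsSeminorm_sq (s : ℝ) (w : Rd d → ℝ) :
    hsSeminorm s w ^ 2 = ENNReal.ofReal (nu d s / 2) * gagliardo s univ univ w := by
  rw [hsSeminorm, ← ENNReal.rpow_natCast, ← ENNReal.rpow_mul]
  norm_num

/-- A function in `H̃ˢ(Ω)` has a measurable representative vanishing off `closure Ω`. -/
theorem MemTildeHs.exists_measurable_ae_eq {s : ℝ} {Ω : Set (Rd d)} {q : Rd d → ℝ}
    (hq : MemTildeHs s Ω q) :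
    ∃ w : Rd d → ℝ, Measurable w ∧ (∀ x ∉ closure Ω, w x = 0) ∧ q =ᵐ[volume] w := by
  have hmeas := hq.1.1.aestronglyMeasurable.aemeasurable
  refine ⟨(closure Ω).indicator (hmeas.mk q), hmeas.measurable_mk.indicator
    isClosed_closure.measurableSet, fun x hx => indicator_of_notMem hx _, ?_⟩
  filter_upwards [hmeas.ae_eq_mk, hq.2] with x h1 h2
  by_cases hx : x ∈ closure Ω
  · rw [indicator_of_mem hx, h1]
  · rw [indicator_of_notMem hx, h2 hx]

end FracLoc

end

theorem mainTheorem10 (d : ℕ) (hd : 1 ≤ d) (s : ℝ) (hs0 : 0 < s) (hs1 : s < 1) (σ : ℝ) :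
    ∃ C : ℝ, 0 < C ∧
      ∀ (Ω : Set (FracLoc.Rd d)), FracLoc.IsBoundedLipschitzDomain Ω →
      ∀ (M : FracLoc.SimplicialMesh d), M.ShapeRegular σ → M.FittedTo Ω →
      ∀ (q : FracLoc.Rd d → ℝ), FracLoc.MemTildeHs s Ω q →
        FracLoc.hsSeminorm s q ^ 2 ≤
          ENNReal.ofReal C *
            ∑ t ∈ M.elementsMeeting Ω,
              (FracLoc.gagliardo s (FracLoc.simplex t) (M.patch t) q +
                eLpNorm q 2 (volume.restrict (FracLoc.simplex t)) ^ 2 /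
                  ENNReal.ofReal (FracLoc.hDiam (FracLoc.simplex t) ^ (2 * s))) := by
  obtain ⟨K, hKfin, hK⟩ := FracLoc.exists_lintegral_truncKernel_le d hs0
  set c : ℝ≥0∞ := ENNReal.ofReal (FracLoc.nu d s / 2) *
    (2 + 8 * (K * ENNReal.ofReal (FracLoc.SimplicialMesh.patchRatio d σ ^ (2 * s)))) with hc
  have hcfin : c ≠ ∞ := by
    have h8 : 8 * (K * ENNReal.ofReal (FracLoc.SimplicialMesh.patchRatio d σ ^ (2 * s))) ≠ ∞ :=
      ENNReal.mul_ne_top (by simp) (ENNReal.mul_ne_top hKfin.ne ENNReal.ofReal_ne_top)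
    exact ENNReal.mul_ne_top ENNReal.ofReal_ne_top (ENNReal.add_ne_top.2 ⟨by simp, h8⟩)
  -- Adding 1 makes the constant positive without knowing the sign of `nu d s`.
  refine ⟨c.toReal + 1, by positivity, fun Ω _ M hσ hfit q hq => ?_⟩
  obtain ⟨w, hw, hw0, hqw⟩ := hq.exists_measurable_ae_eq
  have hmain := hσ.gagliardo_univ_le_sum hd hfit hK hw hw0
  rw [FracLoc.hsSeminorm_sq, FracLoc.gagliardo_congr_ae s univ univ hqw]
  simp_rw [FracLoc.gagliardo_congr_ae s _ _ hqw,
    fun t : Finset (FracLoc.Rd d) => eLpNorm_congr_ae (p := 2)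
      (ae_restrict_of_ae (s := FracLoc.simplex t) hqw)]
  refine (mul_le_mul_right hmain _).trans ?_
  rw [← mul_assoc, ← hc]
  gcongr
  rw [ENNReal.ofReal_add ENNReal.toReal_nonneg zero_le_one, ENNReal.ofReal_toReal hcfin]
  exact le_self_add
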